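/- Let $n,p\in\mathbb{N}$ with $p$ even and $n>p$, and let $\lambda>0$. For $1\le k\le p/2$ let $\mathbf{M}_k\in\mathbb{R}^{p\times p}$ be the matrix whose $(i,j)$ entry is $1$ if ($i=k$ and $k+1\le j\le p$) or ($j=k$ and $k+1\le i\le p$), and $0$ otherwise, and let $$\mathcal{F}^*=\Big\{\boldsymbol{\Sigma}_{\boldsymbol{\theta}}=\mathbf{Id}+\frac{1}{2\sqrt{np}}\sum_{k=1}^{p/2}\theta_k\mathbf{M}_k \;:\; \boldsymbol{\theta}\in\{0,1\}^{p/2}\Big\}.$$ For $\boldsymbol{\Sigma}\in\mathcal{F}^*$ let $\mathbf{Y}^1,\dots,\mathbf{Y}^n$ be i.i.d. copies of $\mathbf{Y}=\mathrm{sign}(\mathbf{X}+\boldsymbol{\tau})\in\{-1,1\}^p$, where $\mathbf{X}\sim\mathcal{N}(\mathbf{0},\boldsymbol{\Sigma})$ and $\boldsymbol{\tau}\sim\mathrm{Unif}([-\lambda,\lambda]^p)$ are independent, and $\mathrm{sign}$ acts componentwise with $\mathrm{sign}(x)=1$ for $x\ge 0$ and $\mathrm{sign}(x)=-1$ for $x<0$.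 Then $$\inf_{\hat{\boldsymbol{\Sigma}}}\ \sup_{\boldsymbol{\Sigma}\in\mathcal{F}^*}\ \mathbb{E}\,\big\|\hat{\boldsymbol{\Sigma}}(\mathbf{Y}^1,\dots,\mathbf{Y}^n)-\boldsymbol{\Sigma}\big\|^2\ \ge\ c\,\frac{p}{n},$$ where the infimum is over all estimators, that is, all functions $\hat{\boldsymbol{\Sigma}}:(\{-1,1\}^p)^n\to\mathbb{R}^{p\times p}$, $\|\cdot\|$ is the operator norm (largest singular value), and $c>0$ is an absolute constant, independent of $n$, $p$ and $\lambda$. -/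

import Mathlib

open MeasureTheory ProbabilityTheory
open scoped ENNReal

namespace DitheredCov

/-- The sign of a real number, with values in `ℤˣ = {1, -1}` and `sign 0 = 1`. -/
noncomputable def sgn (t : ℝ) : ℤˣ := if 0 ≤ t then 1 else -1

/-- The dithered one-bit quantizer `sign (x + τ)`, acting componentwise. -/
noncomputable def quantize {p : ℕ} (x : EuclideanSpace ℝ (Fin p)) (τ : Fin p → ℝ) :
    Fin p → ℤˣ :=
  fun i => sgn (x i + τ i)

/-- The uniform distribution on the cube `[-lam, lam]^p`. -/
noncomputable def ditherLaw (p : ℕ) (lam : ℝ) : Measure (Fin p → ℝ) :=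
  cond volume (Set.Icc (fun _ => -lam) (fun _ => lam))

/-- The law of `Y = sign (X + τ)` on `{-1, 1}^p`, where `X ∼ N(0, S)` and
`τ ∼ Unif([-lam, lam]^p)` are independent. -/
noncomputable def quantizedLaw {p : ℕ} (lam : ℝ) (S : Matrix (Fin p) (Fin p) ℝ) :
    Measure (Fin p → ℤˣ) :=
  ((multivariateGaussian 0 S).prod (ditherLaw p lam)).map (fun z => quantize z.1 z.2)

/-- The law of `n` independent copies `Y¹, …, Yⁿ` of `Y`. -/
noncomputable def sampleLaw {p : ℕ} (n : ℕ) (lam : ℝ) (S : Matrix (Fin p) (Fin p) ℝ) :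
    Measure (Fin n → Fin p → ℤˣ) :=
  Measure.pi (fun _ => quantizedLaw lam S)

/-- The matrix with ones in row `k` and column `k`, strictly to the right of, respectively strictly
below, the diagonal entry `(k, k)`, and zeros elsewhere. -/
def rowColMatrix (p k : ℕ) : Matrix (Fin p) (Fin p) ℝ :=
  Matrix.of fun i j =>
    if ((i : ℕ) = k ∧ k < (j : ℕ)) ∨ ((j : ℕ) = k ∧ k < (i : ℕ)) then 1 else 0

/-- The perturbed identity matrix with parameter `θ ∈ {0, 1}^(p/2)`. -/
noncomputable def perturbedId (n p : ℕ) (θ : Fin (p / 2) → Fin 2) : Matrix (Fin p) (Fin p) ℝ :=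
  1 + (1 / (2 * Real.sqrt ((n : ℝ) * (p : ℝ)))) •
    ∑ k : Fin (p / 2), (((θ k : ℕ) : ℝ) • rowColMatrix p (k : ℕ))

/-- The family of all perturbed identity matrices, for sample size `n` in dimension `p`. -/
def perturbedFamily (n p : ℕ) : Set (Matrix (Fin p) (Fin p) ℝ) :=
  Set.range (perturbedId n p)

open scoped Matrix.Norms.L2Operator in
/-- The mean squared error, in the operator norm on `ℓ²`, of the estimator `est`, as a number in
`[0, ∞]`. The sample space is finite and discrete, so every function on it is measurable. -/
noncomputable def risk {n p : ℕ} (lam : ℝ)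
    (est : (Fin n → Fin p → ℤˣ) → Matrix (Fin p) (Fin p) ℝ)
    (S : Matrix (Fin p) (Fin p) ℝ) : ℝ≥0∞ :=
  ∫⁻ y, ENNReal.ofReal (‖est y - S‖ ^ 2) ∂(sampleLaw n lam S)

/-- The minimax risk over a class `F` of covariance matrices: the infimum is over all estimators,
that is, all matrix-valued functions of the quantized sample. -/
noncomputable def minimaxRisk (n p : ℕ) (lam : ℝ) (F : Set (Matrix (Fin p) (Fin p) ℝ)) : ℝ≥0∞ :=
  ⨅ est : (Fin n → Fin p → ℤˣ) → Matrix (Fin p) (Fin p) ℝ, ⨆ S ∈ F, risk lam est S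

/-- The inherited measurable structure on `ℤˣ = {1, -1}` is the discrete one. -/
instance instDiscreteSign : DiscreteMeasurableSpace ℤˣ where
  forall_measurableSet s :=
    ⟨Units.val '' s, MeasurableSet.of_discrete, Set.preimage_image_eq s Units.val_injective⟩

theorem measurable_quantize (p : ℕ) :
    Measurable (fun z : EuclideanSpace ℝ (Fin p) × (Fin p → ℝ) => quantize z.1 z.2) := by
  refine measurable_pi_lambda _ fun i => ?_
  unfold quantize sgn
  refine Measurable.ite ?_ measurable_const measurable_const
  exact measurableSet_le measurable_const (by fun_prop)

theorem isProbabilityMeasure_ditherLaw (p : ℕ) {lam : ℝ} (hl : 0 < lam) :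
    IsProbabilityMeasure (ditherLaw p lam) := by
  refine cond_isProbabilityMeasure_of_finite ?_ ?_
  · rw [Real.volume_Icc_pi]
    simp [hl]
  · exact isCompact_Icc.measure_lt_top.ne

theorem isProbabilityMeasure_quantizedLaw {p : ℕ} {lam : ℝ} (hl : 0 < lam)
    (S : Matrix (Fin p) (Fin p) ℝ) : IsProbabilityMeasure (quantizedLaw lam S) := by
  have := isProbabilityMeasure_ditherLaw p hl
  exact Measure.isProbabilityMeasure_map (measurable_quantize p).aemeasurable

end DitheredCov

/-! The bound is Assouad's: every bit `θ k` is hard to test, and every wrongly decoded bit costs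
operator norm.

Testing. Flipping one bit changes the covariance by at most `1 / (2n)` in squared Frobenius norm.
Writing `S = T Tᵀ` and `S' = T D Tᵀ`, both quantized samples are images, under one and the same map,
of `n` copies of (product of one-dimensional Gaussians) ⊗ (dither), with variances `1` and `d i`
respectively. Quantization can only lose information, so the test is at least as hard as the one
between the product measures, whose `χ²`-divergence tensorizes and stays below an absolute constant
whatever the dither is (`one_le_mul_sampleLaw_testing_error`).

Separation. With `v` the indicator of the upper half of the coordinates, `(Σ_θ v)_k` is a fixed
multiple of `θ k` for all `k < p / 2` at once. An estimator `B` with many wrong bits therefore has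
`‖(B - Σ_θ) v‖²` large, each wrong bit contributing `1 / (32n)` to the squared operator norm
(`sum_wrongBit_le_norm_sq`). Averaging over the cube (`mul_le_two_mul_iSup_sum_of_flip`) combines
the two. -/

namespace DitheredCov

/-! ### Second moments of densities: tensorization and testing -/

/-- `P` has a density with respect to `Q` whose second moment under `Q` is at most `C`;
for probability measures this says that the `χ²`-divergence is at most `C - 1`. -/
def ChiSqBound {Ω : Type*} [MeasurableSpace Ω] (P Q : Measure Ω) (C : ℝ≥0∞) : Prop :=
  ∃ f : Ω → ℝ≥0∞, Measurable f ∧ P = Q.withDensity f ∧ ∫⁻ x, f x ^ 2 ∂Q ≤ C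

theorem ChiSqBound.mono {Ω : Type*} [MeasurableSpace Ω] {P Q : Measure Ω} {C D : ℝ≥0∞}
    (h : ChiSqBound P Q C) (hCD : C ≤ D) : ChiSqBound P Q D := by
  obtain ⟨f, hf, hP, hC⟩ := h
  exact ⟨f, hf, hP, hC.trans hCD⟩

theorem lintegral_pi_prod_eval {ι : Type*} [Fintype ι] {X : ι → Type*}
    [∀ i, MeasurableSpace (X i)] (Q : ∀ i, Measure (X i)) [∀ i, IsProbabilityMeasure (Q i)]
    {f : ∀ i, X i → ℝ≥0∞} (hf : ∀ i, Measurable (f i)) :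
    ∫⁻ x, ∏ i, f i (x i) ∂(Measure.pi Q) = ∏ i, ∫⁻ t, f i t ∂(Q i) := by
  have hind : iIndepFun (fun i (x : ∀ i, X i) => f i (x i)) (Measure.pi Q) :=
    iIndepFun_pi fun i => (hf i).aemeasurable
  rw [lintegral_prod_eq_prod_lintegral_of_indepFun Finset.univ _ hind
    (fun i => (hf i).comp (measurable_pi_apply i))]
  refine Finset.prod_congr rfl fun i _ => ?_
  exact (measurePreserving_eval Q i).lintegral_comp (hf i)

theorem ChiSqBound.pi {ι : Type*} [Fintype ι] {X : ι → Type*} [∀ i, MeasurableSpace (X i)]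
    {P Q : ∀ i, Measure (X i)} [∀ i, IsProbabilityMeasure (P i)] [∀ i, IsProbabilityMeasure (Q i)]
    {C : ι → ℝ≥0∞} (h : ∀ i, ChiSqBound (P i) (Q i) (C i)) :
    ChiSqBound (Measure.pi P) (Measure.pi Q) (∏ i, C i) := by
  choose f hf hP hC using h
  refine ⟨fun x => ∏ i, f i (x i), by fun_prop, ?_, ?_⟩
  · refine Measure.pi_eq fun s hs => ?_
    rw [withDensity_apply _ (MeasurableSet.univ_pi hs),
      ← lintegral_indicator (MeasurableSet.univ_pi hs)]
    have hind : (Set.univ.pi s).indicator (fun x : ∀ i, X i => ∏ i, f i (x i)) =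
        fun x => ∏ i, (s i).indicator (f i) (x i) := by
      funext x
      by_cases hx : x ∈ Set.univ.pi s
      · rw [Set.indicator_of_mem hx]
        exact Finset.prod_congr rfl fun i _ => (Set.indicator_of_mem (hx i trivial) _).symm
      · rw [Set.indicator_of_notMem hx]
        obtain ⟨i, hi⟩ : ∃ i, x i ∉ s i := by simpa using hx
        exact (Finset.prod_eq_zero (Finset.mem_univ i) (Set.indicator_of_notMem hi _)).symm
    rw [hind, lintegral_pi_prod_eval Q fun i => (hf i).indicator (hs i)]
    refine Finset.prod_congr rfl fun i _ => ?_
    rw [lintegral_indicator (hs i), hP i, withDensity_apply _ (hs i)]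
  · simp_rw [← Finset.prod_pow]
    rw [lintegral_pi_prod_eval Q fun i => (hf i).pow_const 2]
    exact Finset.prod_le_prod' fun i _ => hC i

/-- An independent factor with the same law on both sides, here the dither, leaves the density
unchanged. -/
theorem ChiSqBound.prod_right {Ω Ω' : Type*} [MeasurableSpace Ω] [MeasurableSpace Ω']
    {P Q : Measure Ω} [IsProbabilityMeasure P] [IsProbabilityMeasure Q] {C : ℝ≥0∞}
    (h : ChiSqBound P Q C) (ν : Measure Ω') [IsProbabilityMeasure ν] :
    ChiSqBound (P.prod ν) (Q.prod ν) C := by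
  obtain ⟨f, hf, hP, hC⟩ := h
  have : SFinite (Q.withDensity f) := by rw [← hP]; infer_instance
  refine ⟨fun z => f z.1, by fun_prop, ?_, ?_⟩
  · rw [hP, prod_withDensity_left hf]
  · rw [(measurePreserving_fst (μ := Q) (ν := ν)).lintegral_comp (hf.pow_const 2)]
    exact hC

theorem two_mul_le_inv_mul_sq_add (a : ℝ≥0∞) {C : ℝ≥0∞} (hC : C ≠ 0) (hC' : C ≠ ∞) :
    2 * a ≤ C⁻¹ * a ^ 2 + C := by
  rcases eq_or_ne a ∞ with rfl | ha
  · simp [ENNReal.mul_top, hC']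
  lift a to NNReal using ha
  lift C to NNReal using hC'
  have hC0 : C ≠ 0 := by simpa using hC
  rw [← ENNReal.coe_inv hC0]
  norm_cast
  rw [← NNReal.coe_le_coe]
  push_cast
  have hp : (0 : ℝ) < C := by positivity
  have : (C : ℝ)⁻¹ * (a : ℝ) ^ 2 + C - 2 * a = (C : ℝ)⁻¹ * (a - C) ^ 2 := by
    field_simp
    ring
  have : 0 ≤ (C : ℝ)⁻¹ * ((a : ℝ) - C) ^ 2 := by positivity
  linarith

/-- Testing between `P` and `Q` has error bounded below in terms of the `χ²`-divergence. -/
theorem ChiSqBound.one_le_mul_testing_error {Ω : Type*} [MeasurableSpace Ω] {P Q : Measure Ω}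
    [IsProbabilityMeasure P] {C : ℝ≥0∞} (h : ChiSqBound P Q C) (hC : 2 ≤ C) (hC' : C ≠ ∞)
    {A : Set Ω} (hA : MeasurableSet A) : 1 ≤ C * (Q A + P Aᶜ) := by
  obtain ⟨f, hf, hP, hfC⟩ := h
  have hC0 : C ≠ 0 := by rintro rfl; simp at hC
  -- The pointwise inequality `2f ≤ f² / C + C`, integrated over `A`; the second moment bound turns
  -- the first term into at most `1`.
  have h1 : 2 * P A ≤ 1 + C * Q A := by
    calc 2 * P A = ∫⁻ x in A, 2 * f x ∂Q := by
          rw [hP, withDensity_apply _ hA, lintegral_const_mul _ hf]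
      _ ≤ ∫⁻ x in A, (C⁻¹ * f x ^ 2 + C) ∂Q :=
          lintegral_mono fun x => two_mul_le_inv_mul_sq_add _ hC0 hC'
      _ = C⁻¹ * ∫⁻ x in A, f x ^ 2 ∂Q + C * Q A := by
          rw [lintegral_add_right _ measurable_const, lintegral_const_mul _ (hf.pow_const 2)]
          simp
      _ ≤ C⁻¹ * C + C * Q A := by
          gcongr
          exact (setLIntegral_le_lintegral _ _).trans hfC
      _ = 1 + C * Q A := by rw [ENNReal.inv_mul_cancel hC0 hC']
  have h2 : P A + P Aᶜ = 1 := prob_add_prob_compl hA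
  have h3 : (1 : ℝ≥0∞) + 1 ≤ 1 + C * (Q A + P Aᶜ) := by
    calc (1 : ℝ≥0∞) + 1 = 2 * P A + 2 * P Aᶜ := by rw [← mul_add, h2]; norm_num
      -- The assumption `2 ≤ C` absorbs the factor `2` in front of `P Aᶜ`.
      _ ≤ (1 + C * Q A) + C * P Aᶜ := by gcongr
      _ = 1 + C * (Q A + P Aᶜ) := by ring
  exact (ENNReal.add_le_add_iff_left ENNReal.one_ne_top).1 h3

/-! ### The `χ²`-divergence of one-dimensional centred Gaussians -/

/-- The exponents combine to `-x² / v + x² / 2 = -x² (2 - v) / (2v)`, again a centred Gaussian, of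
variance `v / (2 - v)`; this needs `v < 2`. The constant in front is then the second moment of the
density. -/
theorem gaussianPDFReal_sq_div {v w : NNReal} (hv : 0 < v) (hv2 : (v : ℝ) < 2)
    (hw : (w : ℝ) = v / (2 - v)) (x : ℝ) :
    gaussianPDFReal 0 v x ^ 2 / gaussianPDFReal 0 1 x =
      (√(v * (2 - v)))⁻¹ * gaussianPDFReal 0 w x := by
  have hv' : (0 : ℝ) < v := hv
  have h2 : 0 < 2 - (v : ℝ) := by linarith
  simp only [gaussianPDFReal, NNReal.coe_one, sub_zero, hw]
  have e1 : Real.exp (-x ^ 2 / (2 * (v / (2 - v)))) =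
      Real.exp (-x ^ 2 / (2 * v)) ^ 2 / Real.exp (-x ^ 2 / (2 * 1)) := by
    rw [← Real.exp_nat_mul, ← Real.exp_sub]
    congr 1
    field_simp
    push_cast
    ring
  have e2 : √(2 * Real.pi * (v / (2 - v))) = √(2 * Real.pi) * v / √(v * (2 - v)) := by
    rw [eq_div_iff (by positivity), ← Real.sqrt_mul (by positivity),
      show 2 * Real.pi * (v / (2 - v)) * (v * (2 - v)) = (2 * Real.pi) * (v : ℝ) ^ 2 by
        field_simp, Real.sqrt_mul (by positivity), Real.sqrt_sq hv'.le]
  have e3 : √(2 * Real.pi * v) ^ 2 = 2 * Real.pi * v := Real.sq_sqrt (by positivity)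
  have e4 : √(2 * Real.pi) ^ 2 = 2 * Real.pi := Real.sq_sqrt (by positivity)
  have p1 : 0 < √(v * (2 - v)) := by positivity
  have p2 : 0 < √(2 * Real.pi) := by positivity
  rw [e1, e2, mul_one, mul_pow, inv_pow, e3]
  field_simp
  rw [e4]

theorem chiSqBound_gaussianReal (v : NNReal) (hv : 0 < v) (hv2 : (v : ℝ) < 2) :
    ChiSqBound (gaussianReal 0 v) (gaussianReal 0 1)
      (ENNReal.ofReal (√(v * (2 - v)))⁻¹) := by
  refine ⟨fun x => ENNReal.ofReal (gaussianPDFReal 0 v x / gaussianPDFReal 0 1 x), ?_, ?_, ?_⟩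
  · have h1 := measurable_gaussianPDFReal 0 v
    have h2 := measurable_gaussianPDFReal 0 1
    fun_prop
  · rw [gaussianReal_of_var_ne_zero 0 hv.ne', gaussianReal_of_var_ne_zero 0 one_ne_zero,
      ← withDensity_mul _ (measurable_gaussianPDF _ _)
        (by
          have h1 := measurable_gaussianPDFReal 0 v
          have h2 := measurable_gaussianPDFReal 0 1
          fun_prop)]
    congr 1
    funext x
    have hp := gaussianPDFReal_pos 0 1 x one_ne_zero
    rw [Pi.mul_apply, gaussianPDF_def, gaussianPDF_def, ← ENNReal.ofReal_mul hp.le,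
      mul_div_cancel₀ _ hp.ne']
  · have h2 : 0 < 2 - (v : ℝ) := by linarith
    have hv' : (0 : ℝ) < v := hv
    obtain ⟨w, hw⟩ : ∃ w : NNReal, (w : ℝ) = v / (2 - v) := ⟨⟨v / (2 - v), by positivity⟩, rfl⟩
    rw [gaussianReal_of_var_ne_zero 0 one_ne_zero,
      lintegral_withDensity_eq_lintegral_mul _ (measurable_gaussianPDF _ _)
        (by
          have h1 := measurable_gaussianPDFReal 0 v
          have h2 := measurable_gaussianPDFReal 0 1
          fun_prop)]
    have key : ∀ x, (gaussianPDF 0 1 * fun x =>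
        ENNReal.ofReal (gaussianPDFReal 0 v x / gaussianPDFReal 0 1 x) ^ 2) x =
        ENNReal.ofReal (√(v * (2 - v)))⁻¹ * gaussianPDF 0 w x := by
      intro x
      have hp := gaussianPDFReal_pos 0 1 x one_ne_zero
      rw [Pi.mul_apply, gaussianPDF_def, gaussianPDF_def, ← ENNReal.ofReal_pow
        (div_nonneg (gaussianPDFReal_nonneg _ _ _) hp.le), ← ENNReal.ofReal_mul hp.le,
        ← ENNReal.ofReal_mul (by positivity), ← gaussianPDFReal_sq_div hv hv2 hw]
      congr 1
      field_simp
    simp_rw [key]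
    rw [lintegral_const_mul _ (measurable_gaussianPDF _ _), lintegral_gaussianPDF_eq_one, mul_one]
    have : 0 < (w : ℝ) := by rw [hw]; positivity
    exact (NNReal.coe_pos.1 this).ne'

theorem inv_sqrt_mul_two_sub_le_exp {v : ℝ} (hv : (v - 1) ^ 2 ≤ 2 / 3) :
    (√(v * (2 - v)))⁻¹ ≤ Real.exp (3 / 2 * (v - 1) ^ 2) := by
  set x := (v - 1) ^ 2 with hx
  have h1 : v * (2 - v) = 1 - x := by rw [hx]; ring
  have h0 : 0 ≤ x := sq_nonneg _
  have hpos : 0 < 1 - x := by linarith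
  rw [h1, ← Real.sqrt_inv]
  refine Real.sqrt_le_iff.2 ⟨by positivity, ?_⟩
  rw [← Real.exp_nat_mul]
  -- `(1 - x)(1 + 3x) = 1 + x (2 - 3x)`, which is at least `1` exactly because `0 ≤ x ≤ 2/3`.
  calc (1 - x)⁻¹ ≤ 3 * x + 1 := by
        rw [inv_le_iff_one_le_mul₀ hpos]
        nlinarith
    _ ≤ Real.exp (3 * x) := Real.add_one_le_exp _
    _ = _ := by congr 1; push_cast; ring

theorem chiSqBound_gaussianReal_exp {v : NNReal} (hv : ((v : ℝ) - 1) ^ 2 ≤ 2 / 3) :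
    ChiSqBound (gaussianReal 0 v) (gaussianReal 0 1)
      (ENNReal.ofReal (Real.exp (3 / 2 * ((v : ℝ) - 1) ^ 2))) := by
  have h0 : (v : ℝ) ≠ 0 := by intro h; rw [h] at hv; norm_num at hv
  have hpos : 0 < v := pos_of_ne_zero (by exact_mod_cast h0)
  refine (chiSqBound_gaussianReal v hpos (by nlinarith)).mono ?_
  exact ENNReal.ofReal_le_ofReal (inv_sqrt_mul_two_sub_le_exp hv)

/-! ### Simultaneous diagonalization with Frobenius norm control -/

open Matrix in
theorem trace_mul_self_le_sum_sq {ι : Type*} [Fintype ι] (M : Matrix ι ι ℝ) :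
    (M * M).trace ≤ ∑ i, ∑ j, M i j ^ 2 := by
  have h1 : (M * M).trace = ∑ i, ∑ j, M i j * M j i := by
    simp [Matrix.trace, Matrix.mul_apply]
  have h2 : ∑ i, ∑ j, M j i ^ 2 = ∑ i, ∑ j, M i j ^ 2 := Finset.sum_comm
  have h3 : ∑ i, ∑ j, M i j * M j i ≤ ∑ i, ∑ j, (M i j ^ 2 + M j i ^ 2) / 2 :=
    Finset.sum_le_sum fun i _ => Finset.sum_le_sum fun j _ => by
      nlinarith [sq_nonneg (M i j - M j i)]
  have h4 : ∑ i, ∑ j, (M i j ^ 2 + M j i ^ 2) / 2 = ∑ i, ∑ j, M i j ^ 2 := by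
    simp_rw [← Finset.sum_div, Finset.sum_add_distrib]
    rw [h2]
    ring
  linarith

open Matrix in
-- Expand `0 ≤ |x - 2Sx|²` and bound the cross term by the hypothesis.
theorem dotProduct_self_le_of_half_le {ι : Type*} [Fintype ι] {S : Matrix ι ι ℝ}
    (hS : ∀ x : ι → ℝ, 1 / 2 * (x ⬝ᵥ x) ≤ x ⬝ᵥ S *ᵥ x) (x : ι → ℝ) :
    x ⬝ᵥ x ≤ 4 * (S *ᵥ x ⬝ᵥ S *ᵥ x) := by
  have h1 := hS x
  have h2 : 0 ≤ (x - (2 : ℝ) • S *ᵥ x) ⬝ᵥ (x - (2 : ℝ) • S *ᵥ x) := by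
    simpa using dotProduct_star_self_nonneg (x - (2 : ℝ) • S *ᵥ x)
  simp only [sub_dotProduct, dotProduct_sub, smul_dotProduct, dotProduct_smul, smul_eq_mul,
    dotProduct_comm (S *ᵥ x) x] at h2
  linarith

open Matrix in
theorem sum_sq_le_of_half_le {ι : Type*} [Fintype ι] {S : Matrix ι ι ℝ}
    (hS : ∀ x : ι → ℝ, 1 / 2 * (x ⬝ᵥ x) ≤ x ⬝ᵥ S *ᵥ x) (M : Matrix ι ι ℝ) :
    ∑ i, ∑ j, M i j ^ 2 ≤ 4 * ∑ i, ∑ j, (S * M) i j ^ 2 := by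
  rw [Finset.sum_comm, Finset.sum_comm (f := fun i j => (S * M) i j ^ 2), Finset.mul_sum]
  refine Finset.sum_le_sum fun j _ => ?_
  have h := dotProduct_self_le_of_half_le hS (fun i => M i j)
  simp only [dotProduct, ← sq] at h
  exact h

open Matrix in
open scoped MatrixOrder in
/-- Simultaneous diagonalization by congruence of a positive definite and a symmetric matrix. -/
theorem exists_simultaneous_diagonalization {ι : Type*} [Fintype ι] [DecidableEq ι]
    {S S' : Matrix ι ι ℝ} (hS : S.PosDef) (hS' : S'.IsHermitian) :
    ∃ (T : Matrix ι ι ℝ) (d : ι → ℝ), IsUnit T ∧ S = T * Tᵀ ∧ S' = T * diagonal d * Tᵀ := by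
  obtain ⟨B, hB⟩ : ∃ B : Matrix ι ι ℝ, S = Bᵀ * B := by
    have h : (CFC.sqrt S)ᵀ = CFC.sqrt S := by
      simpa [star_eq_conjTranspose] using (CFC.sqrt_nonneg S).isSelfAdjoint.star_eq
    exact ⟨CFC.sqrt S, by rw [h, CFC.sqrt_mul_sqrt_self S hS.posSemidef.nonneg]⟩
  have hBu : IsUnit B := by
    have h := hS.isUnit
    rw [Matrix.isUnit_iff_isUnit_det, hB, det_mul] at h
    exact (Matrix.isUnit_iff_isUnit_det _).2 (isUnit_of_mul_isUnit_right h)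
  have hBd : IsUnit B.det := (Matrix.isUnit_iff_isUnit_det _).1 hBu
  have hR : ((B⁻¹)ᵀ * S' * B⁻¹).IsHermitian := by
    have := isHermitian_conjTranspose_mul_mul B⁻¹ hS'
    simpa using this
  set U : Matrix ι ι ℝ := hR.eigenvectorUnitary.1 with hU
  have hUU : U * Uᵀ = 1 := by
    have := Unitary.coe_mul_star_self hR.eigenvectorUnitary
    simpa [star_eq_conjTranspose] using this
  have hspec : (B⁻¹)ᵀ * S' * B⁻¹ = U * diagonal hR.eigenvalues * Uᵀ := by
    have := hR.spectral_theorem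
    simpa [Unitary.conjStarAlgAut_apply, star_eq_conjTranspose] using this
  -- With `S = Bᵀ B`, the orthogonal matrix `U` diagonalizes `B⁻ᵀ S' B⁻¹`, so `T = Bᵀ U` serves both
  -- matrices.
  refine ⟨Bᵀ * U, hR.eigenvalues, ?_, ?_, ?_⟩
  · refine IsUnit.mul ?_ (IsUnit.of_mul_eq_one _ hUU)
    exact (Matrix.isUnit_transpose _).2 hBu
  · rw [transpose_mul, transpose_transpose, Matrix.mul_assoc, ← Matrix.mul_assoc U, hUU,
      Matrix.one_mul, hB]
  · have : Bᵀ * U * diagonal hR.eigenvalues * (Bᵀ * U)ᵀ =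
        Bᵀ * (U * diagonal hR.eigenvalues * Uᵀ) * B := by
      rw [transpose_mul, transpose_transpose]
      simp only [Matrix.mul_assoc]
    rw [this, ← hspec]
    have h1 : Bᵀ * (B⁻¹)ᵀ = 1 := by
      rw [← transpose_mul, nonsing_inv_mul _ hBd, transpose_one]
    have h2 : B⁻¹ * B = 1 := nonsing_inv_mul _ hBd
    calc S' = 1 * S' * 1 := by simp
      _ = (Bᵀ * (B⁻¹)ᵀ) * S' * (B⁻¹ * B) := by rw [h1, h2]
      _ = _ := by simp only [Matrix.mul_assoc]

open Matrix in
theorem posDef_of_half_le {ι : Type*} [Fintype ι] {S : Matrix ι ι ℝ} (hS : S.IsHermitian)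
    (hpos : ∀ x : ι → ℝ, 1 / 2 * (x ⬝ᵥ x) ≤ x ⬝ᵥ S *ᵥ x) : S.PosDef := by
  refine PosDef.of_dotProduct_mulVec_pos hS fun x hx => ?_
  have h1 : 0 < x ⬝ᵥ x := by simpa using dotProduct_star_self_pos_iff.2 hx
  have h2 := hpos x
  simp only [star_trivial]
  linarith

open Matrix in
theorem exists_diagonalization_sum_sq_le {ι : Type*} [Fintype ι] [DecidableEq ι]
    {S S' : Matrix ι ι ℝ} (hS : S.IsHermitian) (hS' : S'.IsHermitian)
    (hpos : ∀ x : ι → ℝ, 1 / 2 * (x ⬝ᵥ x) ≤ x ⬝ᵥ S *ᵥ x) :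
    ∃ (T : Matrix ι ι ℝ) (d : ι → ℝ), S = T * Tᵀ ∧ S' = T * diagonal d * Tᵀ ∧
      ∑ i, (d i - 1) ^ 2 ≤ 4 * ∑ i, ∑ j, (S' i j - S i j) ^ 2 := by
  have hSp := posDef_of_half_le hS hpos
  obtain ⟨T, d, hT, h1, h2⟩ := exists_simultaneous_diagonalization hSp hS'
  refine ⟨T, d, h1, h2, ?_⟩
  have hTd : IsUnit T.det := (Matrix.isUnit_iff_isUnit_det _).1 hT
  -- `M` equals `S⁻¹ (S' - S)` and is similar to `D - 1`. Hence `∑ (d i - 1)² = tr M² ≤ ‖M‖_F² ≤ 4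
  -- ‖S' - S‖_F²`.
  set M := (T⁻¹)ᵀ * diagonal (fun i => d i - 1) * Tᵀ with hM
  have t1 : Tᵀ * (T⁻¹)ᵀ = 1 := by rw [← transpose_mul, nonsing_inv_mul _ hTd, transpose_one]
  have hSM : S * M = S' - S := by
    have : diagonal (fun i => d i - 1) = diagonal d - 1 := by
      rw [← diagonal_one, diagonal_sub]
    calc S * M = T * (Tᵀ * (T⁻¹)ᵀ) * diagonal (fun i => d i - 1) * Tᵀ := by
          rw [hM, h1]
          simp only [Matrix.mul_assoc]
      _ = S' - S := by
          rw [t1, this, h2, Matrix.mul_one, Matrix.mul_sub, Matrix.sub_mul, Matrix.mul_one, ← h1]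
  have htr : (M * M).trace = ∑ i, (d i - 1) ^ 2 := by
    have : M * M = (T⁻¹)ᵀ * (diagonal (fun i => d i - 1) * diagonal (fun i => d i - 1) * Tᵀ) := by
      calc M * M = (T⁻¹)ᵀ * (diagonal (fun i => d i - 1) * (Tᵀ * (T⁻¹)ᵀ) *
            diagonal (fun i => d i - 1) * Tᵀ) := by
            rw [hM]
            simp only [Matrix.mul_assoc]
        _ = _ := by rw [t1, Matrix.mul_one]
    rw [this, trace_mul_comm, Matrix.mul_assoc, t1, Matrix.mul_one, diagonal_mul_diagonal,
      trace_diagonal]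
    exact Finset.sum_congr rfl fun i _ => (sq _).symm
  have h3 := trace_mul_self_le_sum_sq M
  have h4 := sum_sq_le_of_half_le hpos M
  rw [hSM] at h4
  simp only [Matrix.sub_apply] at h4
  linarith

/-! ### Quantized samples as images of product measures -/

open Matrix in
-- Both sides have characteristic function `exp (-(tᵀ T D Tᵀ t) / 2)`.
theorem multivariateGaussian_mul_diagonal_mul_transpose {ι : Type*} [Fintype ι] [DecidableEq ι]
    (T : Matrix ι ι ℝ) (d : ι → NNReal) :
    multivariateGaussian 0 (T * diagonal (fun i => (d i : ℝ)) * Tᵀ) =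
      (Measure.pi fun i => gaussianReal 0 (d i)).map
        (fun x => toEuclideanCLM (𝕜 := ℝ) T (WithLp.toLp 2 x)) := by
  have hpsd : (T * diagonal (fun i => (d i : ℝ)) * Tᵀ).PosSemidef := by
    have h : (diagonal (fun i => (d i : ℝ))).PosSemidef :=
      PosSemidef.diagonal fun i => (d i).2
    simpa using h.mul_mul_conjTranspose_same T
  have : (fun x : ι → ℝ => toEuclideanCLM (𝕜 := ℝ) T (WithLp.toLp 2 x)) =
      (toEuclideanCLM (𝕜 := ℝ) T) ∘ (WithLp.toLp 2) := rfl
  rw [this, ← Measure.map_map (by fun_prop) (by fun_prop)]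
  have : IsFiniteMeasure (((Measure.pi fun i => gaussianReal 0 (d i)).map
    (WithLp.toLp 2)).map (toEuclideanCLM (𝕜 := ℝ) T)) := by
      have := Measure.isProbabilityMeasure_map (μ := Measure.pi fun i => gaussianReal 0 (d i))
        (f := WithLp.toLp 2) (Measurable.aemeasurable (by fun_prop))
      exact Measure.isFiniteMeasure_map _ _
  refine Measure.ext_of_charFun (E := EuclideanSpace ℝ ι) ?_
  ext t
  rw [charFun_multivariateGaussian hpsd]
  have hmap : charFun (((Measure.pi fun i => gaussianReal 0 (d i)).map
      (WithLp.toLp 2)).map (toEuclideanCLM (𝕜 := ℝ) T)) t =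
      charFun ((Measure.pi fun i => gaussianReal 0 (d i)).map (WithLp.toLp 2))
        (WithLp.toLp 2 (Tᵀ *ᵥ t.ofLp)) := by
    rw [charFun_apply, charFun_apply, integral_map (by fun_prop) (by fun_prop)]
    refine integral_congr_ae (.of_forall fun x => ?_)
    have : inner ℝ (toEuclideanCLM (𝕜 := ℝ) T x) t =
        inner ℝ x (WithLp.toLp 2 (Tᵀ *ᵥ t.ofLp)) := by
      rw [EuclideanSpace.inner_eq_star_dotProduct, EuclideanSpace.inner_eq_star_dotProduct]
      simp [dotProduct_mulVec, Matrix.mulVec_transpose]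
    simp only [this]
  rw [hmap, charFun_pi]
  simp_rw [charFun_gaussianReal, ← Complex.exp_sum]
  congr 1
  have : t.ofLp ⬝ᵥ (T * diagonal (fun i => (d i : ℝ)) * Tᵀ) *ᵥ t.ofLp =
      ∑ i, (d i : ℝ) * (Tᵀ *ᵥ t.ofLp) i ^ 2 := by
    rw [Matrix.mul_assoc, ← mulVec_mulVec, ← mulVec_mulVec, dotProduct_mulVec,
      ← mulVec_transpose]
    simp only [dotProduct, mulVec_diagonal]
    exact Finset.sum_congr rfl fun i _ => by ring
  rw [this]
  push_cast
  simp [Finset.sum_div]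

theorem prod_ofReal_exp {ι : Type*} [Fintype ι] (a : ι → ℝ) :
    ∏ i, ENNReal.ofReal (Real.exp (a i)) = ENNReal.ofReal (Real.exp (∑ i, a i)) := by
  rw [Real.exp_sum, ENNReal.ofReal_prod_of_nonneg fun i _ => (Real.exp_pos _).le]

open Matrix in
theorem quantizedLaw_mul_diagonal_mul_transpose {p : ℕ} {lam : ℝ} (hl : 0 < lam)
    (T : Matrix (Fin p) (Fin p) ℝ) (d : Fin p → NNReal) :
    quantizedLaw lam (T * diagonal (fun i => (d i : ℝ)) * Tᵀ) =
      ((Measure.pi fun i => gaussianReal 0 (d i)).prod (ditherLaw p lam)).map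
        (fun z => quantize (toEuclideanCLM (𝕜 := ℝ) T (WithLp.toLp 2 z.1)) z.2) := by
  have := isProbabilityMeasure_ditherLaw p hl
  have hm : Measurable fun x : Fin p → ℝ => toEuclideanCLM (𝕜 := ℝ) T (WithLp.toLp 2 x) := by
    fun_prop
  rw [quantizedLaw, multivariateGaussian_mul_diagonal_mul_transpose]
  conv_lhs => rw [← Measure.map_id (μ := ditherLaw p lam)]
  rw [Measure.map_prod_map _ _ hm measurable_id,
    Measure.map_map (measurable_quantize p) (hm.prodMap measurable_id)]
  rfl

open Matrix in
theorem measurable_quantize_comp {p : ℕ} (T : Matrix (Fin p) (Fin p) ℝ) :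
    Measurable fun z : (Fin p → ℝ) × (Fin p → ℝ) =>
      quantize (toEuclideanCLM (𝕜 := ℝ) T (WithLp.toLp 2 z.1)) z.2 :=
  (measurable_quantize p).comp
    ((show Measurable fun x : Fin p → ℝ => toEuclideanCLM (𝕜 := ℝ) T (WithLp.toLp 2 x) by
      fun_prop).prodMap measurable_id)

open Matrix in
-- The map on the right depends on `T` only, so for two covariances with a common `T` the comparison
-- reduces to the product measures.
theorem sampleLaw_mul_diagonal_mul_transpose {p : ℕ} (n : ℕ) {lam : ℝ} (hl : 0 < lam)
    (T : Matrix (Fin p) (Fin p) ℝ) (d : Fin p → NNReal) :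
    sampleLaw n lam (T * diagonal (fun i => (d i : ℝ)) * Tᵀ) =
      (Measure.pi fun _ : Fin n =>
        (Measure.pi fun i => gaussianReal 0 (d i)).prod (ditherLaw p lam)).map
        (fun z j => quantize (toEuclideanCLM (𝕜 := ℝ) T (WithLp.toLp 2 (z j).1)) (z j).2) := by
  have := isProbabilityMeasure_ditherLaw p hl
  have hq := measurable_quantize_comp T
  have : IsProbabilityMeasure (((Measure.pi fun i => gaussianReal 0 (d i)).prod
      (ditherLaw p lam)).map
        (fun z => quantize (toEuclideanCLM (𝕜 := ℝ) T (WithLp.toLp 2 z.1)) z.2)) :=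
    Measure.isProbabilityMeasure_map hq.aemeasurable
  rw [sampleLaw, quantizedLaw_mul_diagonal_mul_transpose hl,
    Measure.pi_map_pi fun _ => hq.aemeasurable]

open Matrix in
/-- Lower bound for the testing error between the quantized samples of two nearby Gaussians. -/
theorem one_le_mul_sampleLaw_testing_error {p : ℕ} (n : ℕ) {lam : ℝ} (hl : 0 < lam)
    {S S' : Matrix (Fin p) (Fin p) ℝ} (hS : S.IsHermitian) (hS' : S'.IsHermitian)
    (hpos : ∀ x : Fin p → ℝ, 1 / 2 * (x ⬝ᵥ x) ≤ x ⬝ᵥ S *ᵥ x)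
    (h1 : 4 * ∑ i, ∑ j, (S' i j - S i j) ^ 2 ≤ 2 / 3)
    (h2 : 6 * (n * ∑ i, ∑ j, (S' i j - S i j) ^ 2) ≤ 3) (A : Set (Fin n → Fin p → ℤˣ)) :
    1 ≤ ENNReal.ofReal (Real.exp 3) * (sampleLaw n lam S A + sampleLaw n lam S' Aᶜ) := by
  obtain ⟨T, d, hT, hTd, hd⟩ := exists_diagonalization_sum_sq_le hS hS' hpos
  have hd1 : ∀ i, (d i - 1) ^ 2 ≤ 2 / 3 := fun i =>
    (Finset.single_le_sum (f := fun i => (d i - 1) ^ 2) (fun i _ => sq_nonneg _)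
      (Finset.mem_univ i)).trans (hd.trans h1)
  -- `(d i - 1)² ≤ 2/3 < 1` keeps each `d i` positive, so it is a legitimate variance.
  have hd0 : ∀ i, 0 ≤ d i := fun i => by nlinarith [hd1 i]
  lift d to Fin p → NNReal using hd0
  have hT1 : S = T * diagonal (fun _ => ((1 : NNReal) : ℝ)) * Tᵀ := by
    simpa using hT
  have := isProbabilityMeasure_ditherLaw p hl
  have hchi := ChiSqBound.pi fun _ : Fin n => ((ChiSqBound.pi fun i =>
    chiSqBound_gaussianReal_exp (hd1 i)).prod_right (ditherLaw p lam))
  simp only [prod_ofReal_exp] at hchi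
  -- The exponent is `n · (3/2) ∑ (d i - 1)² ≤ 6 n ‖S' - S‖_F² ≤ 3`.
  have hC : ENNReal.ofReal (Real.exp (∑ _ : Fin n, ∑ i, 3 / 2 * ((d i : ℝ) - 1) ^ 2)) ≤
      ENNReal.ofReal (Real.exp 3) := by
    refine ENNReal.ofReal_le_ofReal (Real.exp_le_exp.2 ?_)
    rw [Finset.sum_const, Finset.card_univ, Fintype.card_fin, nsmul_eq_mul, ← Finset.mul_sum]
    have := mul_le_mul_of_nonneg_left hd (Nat.cast_nonneg (α := ℝ) n)
    linarith
  have hm : Measurable fun (z : Fin n → (Fin p → ℝ) × (Fin p → ℝ)) j =>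
      quantize (toEuclideanCLM (𝕜 := ℝ) T (WithLp.toLp 2 (z j).1)) (z j).2 :=
    measurable_pi_lambda _ fun j => (measurable_quantize_comp T).comp (measurable_pi_apply j)
  have hA : MeasurableSet A := .of_discrete
  -- Data processing: the test `A` is pulled back along the common map to a test between the product
  -- measures.
  rw [hT1, hTd, sampleLaw_mul_diagonal_mul_transpose n hl, sampleLaw_mul_diagonal_mul_transpose n hl,
    Measure.map_apply hm hA, Measure.map_apply hm hA.compl, Set.preimage_compl]
  refine (hchi.mono hC).one_le_mul_testing_error ?_ ENNReal.ofReal_ne_top (hm hA)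
  rw [show (2 : ℝ≥0∞) = ENNReal.ofReal 2 by simp]
  exact ENNReal.ofReal_le_ofReal (by linarith [Real.add_one_le_exp (3 : ℝ)])

/-! ### Averaging over the cube -/

/-- Assouad's averaging argument over the cube `{0, 1}^m`. -/
theorem mul_le_two_mul_iSup_sum_of_flip {m : ℕ} {c : ℝ≥0∞}
    (e : (Fin m → Fin 2) → Fin m → ℝ≥0∞)
    (h : ∀ θ k, c ≤ e θ k + e (Function.update θ k (θ k + 1)) k) :
    m * c ≤ 2 * ⨆ θ, ∑ k, e θ k := by
  set N : ℝ≥0∞ := (Fintype.card (Fin m → Fin 2) : ℝ≥0∞) with hN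
  have hN0 : N ≠ 0 := by simp [hN]
  have hNt : N ≠ ∞ := ENNReal.natCast_ne_top _
  have hflip : ∀ k, ∑ θ, e (Function.update θ k (θ k + 1)) k = ∑ θ, e θ k := by
    intro k
    have hinv : Function.Involutive
        fun θ : Fin m → Fin 2 => Function.update θ k (θ k + 1) := by
      intro θ
      have : θ k + 1 + 1 = θ k := by
        generalize θ k = b
        fin_cases b <;> rfl
      simp [this]
    exact Equiv.sum_comp hinv.toPerm fun θ => e θ k
  -- Multiplying by the number `N` of vertices turns averages into sums. Flipping bit `k` permutes
  -- the vertices, so the flipped errors have the same total, and a maximum dominates the average.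
  refine (ENNReal.mul_le_mul_iff_right hN0 hNt).1 ?_
  calc N * (m * c) = ∑ _k : Fin m, ∑ _θ : Fin m → Fin 2, c := by
        simp [hN]
        ring
    _ ≤ ∑ k, ∑ θ, (e θ k + e (Function.update θ k (θ k + 1)) k) :=
        Finset.sum_le_sum fun k _ => Finset.sum_le_sum fun θ _ => h θ k
    _ = ∑ k, (∑ θ, e θ k + ∑ θ, e θ k) := by
        simp_rw [Finset.sum_add_distrib, hflip]
    _ = 2 * ∑ θ, ∑ k, e θ k := by
        rw [Finset.sum_add_distrib, ← two_mul, Finset.sum_comm]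
    _ ≤ 2 * ∑ _θ : Fin m → Fin 2, ⨆ θ, ∑ k, e θ k := by
        gcongr with θ
        exact le_iSup (fun θ => ∑ k, e θ k) θ
    _ = N * (2 * ⨆ θ, ∑ k, e θ k) := by
        rw [Finset.sum_const, Finset.card_univ, nsmul_eq_mul, ← hN]
        ring

/-! ### The perturbed identity matrices: lower spectral bound and distances -/

theorem rowColMatrix_nonneg {p : ℕ} (k : ℕ) (i j : Fin p) : 0 ≤ rowColMatrix p k i j := by
  simp only [rowColMatrix, Matrix.of_apply]
  split_ifs <;> norm_num

/-- The matrices for different `k` have disjoint supports, so sums of them with weights in `{0, 1}`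
still have entries in `[0, 1]`. -/
theorem rowColMatrix_le_min {p : ℕ} (k : ℕ) (i j : Fin p) :
    rowColMatrix p k i j ≤ if k = min (i : ℕ) j then 1 else 0 := by
  simp only [rowColMatrix, Matrix.of_apply]
  split_ifs with h1 h2 <;> first | omega | norm_num

theorem sum_sq_rowColMatrix_le (p k : ℕ) :
    ∑ i, ∑ j, rowColMatrix p k i j ^ 2 ≤ 2 * p := by
  have h1 : ∀ t : ℕ, ∑ i : Fin p, (if (i : ℕ) = t then (1 : ℝ) else 0) ≤ 1 := by
    intro t
    rw [Finset.sum_boole]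
    exact_mod_cast Finset.card_le_one.2 fun a ha b hb => Fin.ext (by simp_all)
  have h2 : ∀ i j : Fin p, rowColMatrix p k i j ^ 2 ≤
      (if (i : ℕ) = k then 1 else 0) + if (j : ℕ) = k then 1 else 0 := by
    intro i j
    simp only [rowColMatrix, Matrix.of_apply]
    split_ifs <;> first | omega | norm_num
  calc ∑ i, ∑ j, rowColMatrix p k i j ^ 2
      ≤ ∑ i : Fin p, ∑ j : Fin p,
        ((if (i : ℕ) = k then (1 : ℝ) else 0) + if (j : ℕ) = k then 1 else 0) :=
        Finset.sum_le_sum fun i _ => Finset.sum_le_sum fun j _ => h2 i j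
    _ = p * ∑ i : Fin p, (if (i : ℕ) = k then (1 : ℝ) else 0) +
        p * ∑ j : Fin p, (if (j : ℕ) = k then (1 : ℝ) else 0) := by
        simp_rw [Finset.sum_add_distrib, Finset.sum_const, Finset.card_univ, Fintype.card_fin,
          nsmul_eq_mul, ← Finset.mul_sum]
    _ ≤ p * 1 + p * 1 := by gcongr <;> exact h1 k
    _ = 2 * p := by ring

theorem perturbedId_apply (n p : ℕ) (θ : Fin (p / 2) → Fin 2) (i j : Fin p) :
    perturbedId n p θ i j = (1 : Matrix (Fin p) (Fin p) ℝ) i j +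
      1 / (2 * √((n : ℝ) * p)) * ∑ k, ((θ k : ℕ) : ℝ) * rowColMatrix p k i j := by
  simp [perturbedId, Matrix.sum_apply]

theorem isHermitian_perturbedId (n p : ℕ) (θ : Fin (p / 2) → Fin 2) :
    (perturbedId n p θ).IsHermitian := by
  ext i j
  have : ∀ k : ℕ, rowColMatrix p k j i = rowColMatrix p k i j := by
    intro k
    simp only [rowColMatrix, Matrix.of_apply]
    congr 1
    exact propext or_comm
  simp only [Matrix.conjTranspose_apply, perturbedId_apply, this, star_trivial, Matrix.one_apply,
    eq_comm]

theorem fin_two_cast_le_one (b : Fin 2) : ((b : ℕ) : ℝ) ≤ 1 := by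
  exact_mod_cast Nat.lt_succ_iff.1 b.2

theorem sum_rowColMatrix_nonneg {p : ℕ} (θ : Fin (p / 2) → Fin 2) (i j : Fin p) :
    0 ≤ ∑ k, ((θ k : ℕ) : ℝ) * rowColMatrix p k i j :=
  Finset.sum_nonneg fun _ _ => mul_nonneg (Nat.cast_nonneg _) (rowColMatrix_nonneg _ _ _)

theorem sum_rowColMatrix_le_one {p : ℕ} (θ : Fin (p / 2) → Fin 2) (i j : Fin p) :
    ∑ k, ((θ k : ℕ) : ℝ) * rowColMatrix p k i j ≤ 1 := by
  calc ∑ k, ((θ k : ℕ) : ℝ) * rowColMatrix p k i j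
      ≤ ∑ k : Fin (p / 2), (if (k : ℕ) = min (i : ℕ) j then (1 : ℝ) else 0) := by
        refine Finset.sum_le_sum fun k _ => ?_
        refine le_trans ?_ (rowColMatrix_le_min k i j)
        exact mul_le_of_le_one_left (rowColMatrix_nonneg _ _ _) (fin_two_cast_le_one _)
    _ ≤ 1 := by
        rw [Finset.sum_boole]
        exact_mod_cast Finset.card_le_one.2 fun a ha b hb => Fin.ext (by simp_all)

open Matrix in
theorem half_le_perturbedId {n p : ℕ} (hnp : p < n) (θ : Fin (p / 2) → Fin 2) (x : Fin p → ℝ) :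
    1 / 2 * (x ⬝ᵥ x) ≤ x ⬝ᵥ perturbedId n p θ *ᵥ x := by
  rcases Nat.eq_zero_or_pos p with rfl | hp
  · simp [dotProduct]
  set ε : ℝ := 1 / (2 * √((n : ℝ) * p)) with hε
  have hp' : (0 : ℝ) < p := by exact_mod_cast hp
  have hnp' : (p : ℝ) ≤ n := by exact_mod_cast hnp.le
  have hn' : (0 : ℝ) < n := hp'.trans_le hnp'
  have hsq : (p : ℝ) ≤ √((n : ℝ) * p) := Real.le_sqrt_of_sq_le (by nlinarith)
  have hε0 : 0 ≤ ε := by positivity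
  -- Since `p < n`, one has `p ≤ √(np)`. The perturbation has entries in `[0, ε]`, hence a quadratic
  -- form at least `-ε p |x|² ≥ -|x|² / 2`.
  have hεp : ε * p ≤ 1 / 2 := by
    rw [hε, div_mul_eq_mul_div, one_mul, div_le_iff₀ (by positivity)]
    linarith
  set a : Fin p → Fin p → ℝ := fun i j => ∑ k, ((θ k : ℕ) : ℝ) * rowColMatrix p k i j with ha
  have hquad : x ⬝ᵥ perturbedId n p θ *ᵥ x = x ⬝ᵥ x + ε * ∑ i, ∑ j, a i j * (x i * x j) := by
    have : perturbedId n p θ = 1 + ε • Matrix.of a := by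
      ext i j
      simp [perturbedId_apply, ha, hε]
    rw [this, add_mulVec, one_mulVec, dotProduct_add, smul_mulVec, dotProduct_smul, smul_eq_mul]
    congr 2
    simp only [dotProduct, mulVec, of_apply, Finset.mul_sum]
    exact Finset.sum_congr rfl fun i _ => Finset.sum_congr rfl fun j _ => by ring
  have hsum : -(p * (x ⬝ᵥ x)) ≤ ∑ i, ∑ j, a i j * (x i * x j) := by
    have h1 : ∑ i : Fin p, ∑ j : Fin p, -((x i ^ 2 + x j ^ 2) / 2) = -(p * (x ⬝ᵥ x)) := by
      simp_rw [Finset.sum_neg_distrib, ← Finset.sum_div, Finset.sum_add_distrib, Finset.sum_const,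
        Finset.card_univ, Fintype.card_fin, nsmul_eq_mul, ← Finset.mul_sum, dotProduct, ← sq]
      ring
    rw [← h1]
    refine Finset.sum_le_sum fun i _ => Finset.sum_le_sum fun j _ => ?_
    have h0 : 0 ≤ a i j := sum_rowColMatrix_nonneg θ i j
    have h1 : a i j ≤ 1 := sum_rowColMatrix_le_one θ i j
    nlinarith [mul_nonneg h0 (sq_nonneg (x i + x j)),
      mul_nonneg (sub_nonneg.2 h1) (add_nonneg (sq_nonneg (x i)) (sq_nonneg (x j)))]
  have hxx : 0 ≤ x ⬝ᵥ x := by simpa using dotProduct_star_self_nonneg x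
  rw [hquad]
  nlinarith [mul_le_mul_of_nonneg_left hsum hε0, mul_le_mul_of_nonneg_right hεp hxx]

theorem sum_sq_perturbedId_update_sub_le {n p : ℕ} (hn : 0 < n) (hp : 0 < p)
    (θ : Fin (p / 2) → Fin 2) (k : Fin (p / 2)) (b : Fin 2) :
    ∑ i, ∑ j, (perturbedId n p (Function.update θ k b) i j - perturbedId n p θ i j) ^ 2 ≤
      1 / (2 * n) := by
  have hp' : (0 : ℝ) < p := by exact_mod_cast hp
  have hn' : (0 : ℝ) < n := by exact_mod_cast hn
  set ε : ℝ := 1 / (2 * √((n : ℝ) * p)) with hε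
  -- The scaling `1 / (2 √(np))` makes the squared Frobenius distance of neighbours independent of
  -- `p`.
  have hε2 : ε ^ 2 * (2 * p) = 1 / (2 * n) := by
    rw [hε, div_pow, mul_pow, Real.sq_sqrt (by positivity)]
    field_simp
  set t : ℝ := ((b : ℕ) : ℝ) - ((θ k : ℕ) : ℝ) with ht
  have ht2 : t ^ 2 ≤ 1 := by
    have h1 := fin_two_cast_le_one b
    have h2 := fin_two_cast_le_one (θ k)
    have h3 : (0 : ℝ) ≤ ((b : ℕ) : ℝ) := Nat.cast_nonneg _
    have h4 : (0 : ℝ) ≤ ((θ k : ℕ) : ℝ) := Nat.cast_nonneg _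
    rw [sq_le_one_iff_abs_le_one, abs_le]
    constructor <;> linarith
  have hdiff : ∀ i j, perturbedId n p (Function.update θ k b) i j - perturbedId n p θ i j =
      ε * (t * rowColMatrix p k i j) := by
    intro i j
    rw [perturbedId_apply, perturbedId_apply, add_sub_add_left_eq_sub, ← mul_sub,
      ← Finset.sum_sub_distrib, Finset.sum_eq_single k]
    · rw [Function.update_self, ← sub_mul]
    · intro l _ hl
      rw [Function.update_of_ne hl, sub_self]
    · simp
  simp_rw [hdiff, mul_pow, ← Finset.mul_sum]
  have hF := sum_sq_rowColMatrix_le p k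
  have hF0 : 0 ≤ ∑ i, ∑ j, rowColMatrix p k i j ^ 2 := by positivity
  rw [← hε2]
  have : t ^ 2 * ∑ i, ∑ j, rowColMatrix p k i j ^ 2 ≤ 2 * p := by nlinarith
  gcongr

/-! ### Reading the bits off a matrix -/

open Matrix in
open scoped Matrix.Norms.L2Operator in
theorem sum_mulVec_sq_le {ι : Type*} [Fintype ι] [DecidableEq ι] (M : Matrix ι ι ℝ) (x : ι → ℝ) :
    ∑ i, (M *ᵥ x) i ^ 2 ≤ ‖M‖ ^ 2 * ∑ i, x i ^ 2 := by
  have h := Matrix.l2_opNorm_mulVec M (WithLp.toLp 2 x)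
  have h2 := pow_le_pow_left₀ (norm_nonneg _) h 2
  rw [mul_pow, EuclideanSpace.real_norm_sq_eq, EuclideanSpace.real_norm_sq_eq] at h2
  simpa using h2

/-- The indicator vector of the second half of the coordinates. -/
def upperHalf (p : ℕ) : Fin p → ℝ := fun j => if p / 2 ≤ (j : ℕ) then 1 else 0

theorem sum_upperHalf {p : ℕ} (hp : 2 * (p / 2) = p) : ∑ j, upperHalf p j = (p : ℝ) / 2 := by
  have h : (p : ℝ) = ((p / 2 + p / 2 : ℕ) : ℝ) := by congr 1; omega
  have h1 : ∑ j, upperHalf p j = ((p / 2 : ℕ) : ℝ) := by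
    unfold upperHalf
    rw [Fin.sum_univ_eq_sum_range (fun j => if p / 2 ≤ j then (1 : ℝ) else 0), Finset.sum_boole]
    congr 1
    have : (Finset.range p).filter (fun j => p / 2 ≤ j) = Finset.Ico (p / 2) p := by
      ext j
      simp only [Finset.mem_filter, Finset.mem_range, Finset.mem_Ico]
      omega
    rw [this, Nat.card_Ico]
    omega
  rw [h1, h]
  push_cast
  ring

theorem sum_upperHalf_sq {p : ℕ} (hp : 2 * (p / 2) = p) :
    ∑ j, upperHalf p j ^ 2 = (p : ℝ) / 2 := by
  rw [← sum_upperHalf hp]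
  refine Finset.sum_congr rfl fun j _ => ?_
  unfold upperHalf
  split_ifs <;> norm_num

open Matrix in
-- For `k < p / 2 ≤ j` the entry `(k, j)` is off the diagonal and only the `k`-th matrix is nonzero
-- there; the `p / 2` such columns add up.
theorem perturbedId_mulVec_upperHalf {n p : ℕ} (hp : 2 * (p / 2) = p) (θ : Fin (p / 2) → Fin 2)
    (k : Fin (p / 2)) :
    (perturbedId n p θ *ᵥ upperHalf p) (k.castLE (Nat.div_le_self p 2)) =
      1 / (2 * √((n : ℝ) * p)) * (p / 2) * ((θ k : ℕ) : ℝ) := by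
  set i : Fin p := k.castLE (Nat.div_le_self p 2) with hi
  have hik : (i : ℕ) = k := rfl
  have hterm : ∀ j, perturbedId n p θ i j * upperHalf p j =
      1 / (2 * √((n : ℝ) * p)) * ((θ k : ℕ) : ℝ) * upperHalf p j := by
    intro j
    by_cases hj : p / 2 ≤ (j : ℕ)
    · have hij : i ≠ j := by
        intro h
        have := k.2
        rw [← h, hik] at hj
        omega
      rw [perturbedId_apply, Matrix.one_apply_ne hij, zero_add, Finset.sum_eq_single k]
      · have : rowColMatrix p k i j = 1 := by
          simp only [rowColMatrix, Matrix.of_apply]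
          exact if_pos (Or.inl ⟨hik, k.2.trans_le hj⟩)
        rw [this, mul_one]
      · intro l _ hl
        have : rowColMatrix p l i j = 0 := by
          simp only [rowColMatrix, Matrix.of_apply]
          refine if_neg ?_
          have h1 : (l : ℕ) ≠ k := fun h => hl (Fin.ext h)
          have h2 := l.2
          omega
        rw [this, mul_zero]
      · simp
    · simp [upperHalf, hj]
  simp only [mulVec, dotProduct, hterm, ← Finset.mul_sum, sum_upperHalf hp]
  ring

/-- The set of matrices `B` for which thresholding the `k`-th coordinate of `B *ᵥ upperHalf p`
does not recover the bit `b` of a perturbed identity matrix. -/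
def wrongBit (n p : ℕ) (k : Fin (p / 2)) (b : Fin 2) : Set (Matrix (Fin p) (Fin p) ℝ) :=
  {B | (1 / (2 * √((n : ℝ) * p)) * (p / 2) / 2 ≤
    (B.mulVec (upperHalf p)) (k.castLE (Nat.div_le_self p 2))) ↔ b = 0}

/-- At two vertices differing in bit `k`, the decoding errors are complementary events, that is, the
two errors of a single test. -/
theorem wrongBit_add_one (n p : ℕ) (k : Fin (p / 2)) (b : Fin 2) :
    wrongBit n p k (b + 1) = (wrongBit n p k b)ᶜ := by
  ext B
  simp only [wrongBit, Set.mem_ofPred_eq, Set.mem_compl_iff]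
  fin_cases b <;> simp

open Matrix in
-- The threshold lies midway between the values for bits `0` and `1`, so a wrong decision means a
-- deviation of at least half the gap.
theorem sq_le_sq_sub_of_mem_wrongBit {n p : ℕ} (hp : 2 * (p / 2) = p) (θ : Fin (p / 2) → Fin 2)
    (k : Fin (p / 2)) {B : Matrix (Fin p) (Fin p) ℝ} (hB : B ∈ wrongBit n p k (θ k)) :
    (1 / (2 * √((n : ℝ) * p)) * (p / 2) / 2) ^ 2 ≤
      (((B - perturbedId n p θ) *ᵥ upperHalf p) (k.castLE (Nat.div_le_self p 2))) ^ 2 := by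
  rw [sub_mulVec, Pi.sub_apply, perturbedId_mulVec_upperHalf hp]
  simp only [wrongBit, Set.mem_ofPred_eq] at hB
  set a := 1 / (2 * √((n : ℝ) * p)) * (p / 2) with ha
  have ha0 : 0 ≤ a := by positivity
  rcases Fin.exists_fin_two.1 ⟨θ k, rfl⟩ with h | h
  · rw [h] at hB ⊢
    have := hB.2 rfl
    refine pow_le_pow_left₀ (by positivity) ?_ 2
    simpa using this
  · rw [h] at hB ⊢
    have : ¬ _ := fun h' => absurd (hB.1 h') (by decide)
    rw [not_le] at this
    rw [← neg_sq (_ - _)]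
    refine pow_le_pow_left₀ (by positivity) ?_ 2
    simp
    linarith

open Classical in
open scoped Matrix.Norms.L2Operator in
theorem sum_wrongBit_le_norm_sq {n p : ℕ} (hp : 2 * (p / 2) = p) (hp0 : 0 < p) (hn : 0 < n)
    (θ : Fin (p / 2) → Fin 2) (B : Matrix (Fin p) (Fin p) ℝ) :
    ∑ k, (if B ∈ wrongBit n p k (θ k) then 1 / (32 * (n : ℝ)) else 0) ≤
      ‖B - perturbedId n p θ‖ ^ 2 := by
  have hp' : (0 : ℝ) < p := by exact_mod_cast hp0
  have hn' : (0 : ℝ) < n := by exact_mod_cast hn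
  set v := (B - perturbedId n p θ).mulVec (upperHalf p) with hv
  have h1 := sum_mulVec_sq_le (B - perturbedId n p θ) (upperHalf p)
  rw [sum_upperHalf_sq hp, ← hv] at h1
  have h2 : ∑ k : Fin (p / 2), v (k.castLE (Nat.div_le_self p 2)) ^ 2 ≤ ∑ i, v i ^ 2 := by
    have := Finset.sum_map Finset.univ (Fin.castLEEmb (Nat.div_le_self p 2)) (fun i => v i ^ 2)
    exact this.symm.trans_le <|
      Finset.sum_le_sum_of_subset_of_nonneg (Finset.subset_univ _) fun _ _ _ => sq_nonneg _
  -- A wrong bit deviates by at least `p / (8 √(np))`, whose square `p / (64n)` is `1 / (32n)` times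
  -- `‖upperHalf p‖² = p / 2`.
  have h3 : ∀ k, (if B ∈ wrongBit n p k (θ k) then 1 / (32 * (n : ℝ)) else 0) * ((p : ℝ) / 2) ≤
      v (k.castLE (Nat.div_le_self p 2)) ^ 2 := by
    intro k
    split_ifs with h
    · refine le_of_eq_of_le ?_ (sq_le_sq_sub_of_mem_wrongBit hp θ k h)
      rw [div_pow, mul_pow, div_pow, mul_pow, Real.sq_sqrt (by positivity)]
      field_simp
      norm_num
    · rw [zero_mul]
      exact sq_nonneg _
  refine le_of_mul_le_mul_right ?_ (half_pos hp')
  rw [Finset.sum_mul]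
  exact (Finset.sum_le_sum fun k _ => h3 k).trans (h2.trans h1)

/-! ### The minimax bound -/

theorem risk_perturbedId_ge {n p : ℕ} (hp : 2 * (p / 2) = p) (hp0 : 0 < p) (hn : 0 < n) (lam : ℝ)
    (est : (Fin n → Fin p → ℤˣ) → Matrix (Fin p) (Fin p) ℝ) (θ : Fin (p / 2) → Fin 2) :
    ENNReal.ofReal (1 / (32 * (n : ℝ))) *
      ∑ k, sampleLaw n lam (perturbedId n p θ) (est ⁻¹' wrongBit n p k (θ k)) ≤
      risk lam est (perturbedId n p θ) := by
  classical
  rw [Finset.mul_sum]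
  calc ∑ k, ENNReal.ofReal (1 / (32 * (n : ℝ))) *
        sampleLaw n lam (perturbedId n p θ) (est ⁻¹' wrongBit n p k (θ k))
      = ∑ k, ∫⁻ y, (est ⁻¹' wrongBit n p k (θ k)).indicator
          (fun _ => ENNReal.ofReal (1 / (32 * (n : ℝ)))) y
          ∂(sampleLaw n lam (perturbedId n p θ)) :=
        Finset.sum_congr rfl fun k _ => (lintegral_indicator_const .of_discrete _).symm
    _ = ∫⁻ y, ∑ k, (est ⁻¹' wrongBit n p k (θ k)).indicator
          (fun _ => ENNReal.ofReal (1 / (32 * (n : ℝ)))) y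
          ∂(sampleLaw n lam (perturbedId n p θ)) :=
        (lintegral_finsetSum _ fun k _ => Measurable.of_discrete).symm
    _ ≤ risk lam est (perturbedId n p θ) := by
        refine lintegral_mono fun y => ?_
        refine le_trans (le_of_eq ?_)
          (ENNReal.ofReal_le_ofReal (sum_wrongBit_le_norm_sq hp hp0 hn θ (est y)))
        rw [ENNReal.ofReal_sum_of_nonneg fun k _ => by split_ifs <;> positivity]
        refine Finset.sum_congr rfl fun k _ => ?_
        by_cases h : est y ∈ wrongBit n p k (θ k)
        · rw [if_pos h, Set.indicator_of_mem (Set.mem_preimage.2 h)]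
        · rw [if_neg h, Set.indicator_of_notMem (by exact h), ENNReal.ofReal_zero]

theorem one_le_mul_testing_error_perturbedId {n p : ℕ} (hp0 : 0 < p) (hn : 3 ≤ n) (hnp : p < n)
    {lam : ℝ} (hl : 0 < lam) (θ : Fin (p / 2) → Fin 2) (k : Fin (p / 2)) (b : Fin 2)
    (A : Set (Fin n → Fin p → ℤˣ)) :
    1 ≤ ENNReal.ofReal (Real.exp 3) * (sampleLaw n lam (perturbedId n p θ) A +
      sampleLaw n lam (perturbedId n p (Function.update θ k b)) Aᶜ) := by
  have hn' : (3 : ℝ) ≤ n := by exact_mod_cast hn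
  have hF := sum_sq_perturbedId_update_sub_le (by omega : 0 < n) hp0 θ k b
  have h6 : 1 / (2 * (n : ℝ)) ≤ 1 / 6 := one_div_le_one_div_of_le (by norm_num) (by linarith)
  -- The Frobenius bound `1 / (2n)` gives `4 / (2n) ≤ 2/3` because `n ≥ 3`, and `6 n / (2n) = 3`.
  refine one_le_mul_sampleLaw_testing_error n hl (isHermitian_perturbedId n p θ)
    (isHermitian_perturbedId n p _) (half_le_perturbedId hnp θ) (by linarith) ?_ A
  have h := mul_le_mul_of_nonneg_left hF (by linarith : (0 : ℝ) ≤ n)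
  have h' : (n : ℝ) * (1 / (2 * n)) = 1 / 2 := by
    field_simp
  linarith

theorem iSup_risk_perturbedFamily_ge {n p : ℕ} (hp : 2 * (p / 2) = p) (hp0 : 0 < p) (hnp : p < n)
    {lam : ℝ} (hl : 0 < lam) (est : (Fin n → Fin p → ℤˣ) → Matrix (Fin p) (Fin p) ℝ) :
    ENNReal.ofReal (Real.exp (-3) / 128 * ((p : ℝ) / n)) ≤
      ⨆ S ∈ perturbedFamily n p, risk lam est S := by
  set e : (Fin (p / 2) → Fin 2) → Fin (p / 2) → ℝ≥0∞ := fun θ k =>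
    sampleLaw n lam (perturbedId n p θ) (est ⁻¹' wrongBit n p k (θ k)) with he
  set C := ENNReal.ofReal (Real.exp 3) with hC
  have hflip : ∀ θ k, ENNReal.ofReal (Real.exp (-3)) ≤
      e θ k + e (Function.update θ k (θ k + 1)) k := by
    intro θ k
    -- `3 ≤ n` holds because `p` is even and positive, so `2 ≤ p < n`.
    have h := one_le_mul_testing_error_perturbedId hp0 (by omega) hnp hl θ k (θ k + 1)
      (est ⁻¹' wrongBit n p k (θ k))
    simp only [he, Function.update_self, wrongBit_add_one, Set.preimage_compl]
    calc ENNReal.ofReal (Real.exp (-3)) = ENNReal.ofReal (Real.exp (-3)) * 1 := (mul_one _).symm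
      _ ≤ ENNReal.ofReal (Real.exp (-3)) * (C * _) := by gcongr
      _ = _ := by
        rw [← mul_assoc, hC, ← ENNReal.ofReal_mul (Real.exp_pos _).le, ← Real.exp_add]
        simp
  have hA := mul_le_two_mul_iSup_sum_of_flip e hflip
  have hn' : (0 : ℝ) < n := by exact_mod_cast (by omega : 0 < n)
  have hpr : ((p / 2 : ℕ) : ℝ) = p / 2 := by
    have : ((2 * (p / 2) : ℕ) : ℝ) = p := by rw [hp]
    push_cast at this
    linarith
  -- The constant: `p / 2` bits, cost `1 / (32n)` each, and an average error of `exp (-3) / 2` per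
  -- bit.
  calc ENNReal.ofReal (Real.exp (-3) / 128 * ((p : ℝ) / n))
      = ENNReal.ofReal (1 / (64 * (n : ℝ))) *
        (((p / 2 : ℕ) : ℝ≥0∞) * ENNReal.ofReal (Real.exp (-3))) := by
        rw [← ENNReal.ofReal_natCast, hpr, ← ENNReal.ofReal_mul (by positivity),
          ← ENNReal.ofReal_mul (by positivity)]
        congr 1
        field_simp
        norm_num
    _ ≤ ENNReal.ofReal (1 / (64 * (n : ℝ))) * (2 * ⨆ θ, ∑ k, e θ k) := by gcongr
    _ = ⨆ θ, ENNReal.ofReal (1 / (32 * (n : ℝ))) * ∑ k, e θ k := by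
        rw [← mul_assoc, ENNReal.mul_iSup, show (2 : ℝ≥0∞) = ENNReal.ofReal 2 by simp,
          ← ENNReal.ofReal_mul (by positivity)]
        congr! 4
        field_simp
        norm_num
    _ ≤ ⨆ S ∈ perturbedFamily n p, risk lam est S := by
        refine iSup_le fun θ => ?_
        exact (risk_perturbedId_ge hp hp0 (by omega) lam est θ).trans
          (le_iSup₂ (f := fun S (_ : S ∈ perturbedFamily n p) => risk lam est S)
            (perturbedId n p θ) ⟨θ, rfl⟩)

end DitheredCov

theorem mainTheorem4 :
    ∃ c : ℝ, 0 < c ∧ ∀ (n p : ℕ), Even p → p < n → ∀ lam : ℝ, 0 < lam →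
      ENNReal.ofReal (c * ((p : ℝ) / (n : ℝ))) ≤
        DitheredCov.minimaxRisk n p lam (DitheredCov.perturbedFamily n p) := by
  refine ⟨Real.exp (-3) / 128, by positivity, fun n p hp hnp lam hl => ?_⟩
  -- For `p = 0` the bound is `0`.
  rcases Nat.eq_zero_or_pos p with rfl | hp0
  · simp
  · exact le_iInf fun est => DitheredCov.iSup_risk_perturbedFamily_ge
      (Nat.two_mul_div_two_of_even hp) hp0 hnp hl est
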